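/- Fix integers $n\ge 0$, $q\ge1$. Let $C\subsetneq\mathbb R^q$, $C\neq\{0\}$, be a closed convex pointed polyhedral cone with non-empty interior, let $X\subseteq\mathbb R^n$ be closed and convex with $\operatorname{int}X\neq\emptyset$, and let $\Gamma:X\to\mathbb R^q$ be continuous and $C$-convex, i.e. $\Gamma(\alpha x+(1-\alpha)y)\le_C\alpha\Gamma(x)+(1-\alpha)\Gamma(y)$ for $x,y\in X$, $\alpha\in[0,1]$, where $u\le_C w$ means $w-u\in C$. Write $\|\cdot\|$ for the $\ell_1$ norm, $B_1(0)$ for its closed unit ball, $\operatorname{cone}A$ for the convex conic hull ($\operatorname{cone}\emptyset=\{0\}$), $A^+=\{z: z^{\mathsf T}a\ge0\ \forall a\in A\}$, $A_\infty=\{d: y+\alpha d\in A\ \forall y\in A,\alpha\ge0\}$, and $\operatorname{vert}A$ for the set of vertices (extreme points) of $A$. An extreme direction of a cone $D$ is a nonzero $y\in D$ that is not a convex combination of elements of $D\setminus\operatorname{cone}\{y\}$. Fix $c\in\operatorname{int}C$ with $\|c\|=1$, a nonsingular $T\in\mathbb R^{q\times q}$ with last column $c$, a finite set $R$ with $\operatorname{cone}R=C$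 and $\|d\|=1$ for $d\in R$, a finite set $R^*$ with $\operatorname{cone}R^*=C^+$ and $c^{\mathsf T}z=1$ for $z\in R^*$, and $\delta>0$. Consider the scalar problems - $P_1(w)$: minimize $w^{\mathsf T}\Gamma(x)$ over $x\in X$; - $P_2(v,d)$, $d\ne0$: maximize $\lambda$ over $x\in X$, $\lambda\in\mathbb R$ with $\Gamma(x)-v-\lambda d\le_C0$; - $D_2(v,d)$: minimize $\sup_{x\in X}\{-w^{\mathsf T}\Gamma(x)\}+w^{\mathsf T}v$ over $w\in C^+$ with $w^{\mathsf T}d=-1$. Algorithm 1. 1. Set $Y_{In}=R$, $\hat C=\emptyset$, $P_0=\mathbb R^q$, $\bar X=\emptyset$, $\bar T=\emptyset$, $b=1$. 2. Choose $x_0\in X$ and set $v=\Gamma(x_0)+\sum_{d\in R}d$. 3. For every $z\in R^*$: if $P_1(z)$ is unbounded, set $b=0$; if $x^*$ is an optimal solution of $P_1(z)$, add $x^*$ to $\bar X$, add $T^{\mathsf T}z$ to $\bar T$, and replace $P_0$ by $P_0\cap\{y: z^{\mathsf T}(y-\Gamma(x^*))\ge0\}$. 4. If $b=1$, set $Y_{Out}=R$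 and stop. 5. For every $d\in-R$: if $P_2(v,d)$ is unbounded, add $d$ to $Y_{In}$; if $(x,\lambda)$ and $w$ are optimal solutions of $P_2(v,d)$ and $D_2(v,d)$, perform the update $U(x,w)$: add $x$ to $\bar X$, add $T^{\mathsf T}\frac{w}{c^{\mathsf T}w}$ to $\bar T$, and replace $P_0$ by $P_0\cap\{y: w^{\mathsf T}(y-\Gamma(x))\ge0\}$. 6. Set $Y_{Out}=\operatorname{vert}((P_0)_\infty\cap B_1(0))\setminus\{0\}$. 7. While $Y_{Out}\setminus(Y_{In}\cup\hat C)\neq\emptyset$, take an element $d$ of it and some $\tilde r\in Y_{In}$ minimizing $\|d-r\|$ over $r\in Y_{In}$. If $\|d-\tilde r\|\le\delta$, add $d$ to $\hat C$. Otherwise choose $\mu\in(0,1)$ with $e=\mu d+(1-\mu)\tilde r\neq0$; if $P_2(v,e)$ is unbounded, add $e/\|e\|$ to $Y_{In}$; if $(x,\lambda)$ and $w$ are optimal solutions of $P_2(v,e)$ and $D_2(v,e)$, perform $U(x,w)$ and recompute $Y_{Out}=\operatorname{vert}((P_0)_\infty\cap B_1(0))\setminus\{0\}$. For $t\in\mathbb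 R^q$ let $w(t)=\big((t_1,\dots,t_{q-1},1)T^{-1}\big)^{\mathsf T}$ and $D^*(t)=\big(t_1,\dots,t_{q-1},\inf_{x\in X}w(t)^{\mathsf T}\Gamma(x)\big)^{\mathsf T}\in\mathbb R^{q-1}\times[-\infty,\infty]$, and let $K=\{(0,\dots,0,k)^{\mathsf T}: k\ge0\}$. The modified geometric dual problem (D') is to maximize $D^*(t)$ with respect to $\le_K$ over $\mathcal T'=\{t: w(t)\in(\operatorname{cone}Y_{Out})^+\}$; $t$ is a maximizer of (D') if $t\in\mathcal T'$ and $D^*(t)$ is $K$-maximal in $D^*(\mathcal T')$, i.e. $(\{D^*(t)\}+K\setminus\{0\})\cap D^*(\mathcal T')=\emptyset$ (with $-\infty+k=-\infty$). Lemma. Suppose that a run of Algorithm 1 (with arbitrary choices of optimal solutions, processing order, $d$, $\tilde r$ and $\mu$) terminates after finitely many steps, and let $\bar T$ and $Y_{Out}$ be the sets it returns. Then: 1. $\bar T\supseteq\{T^{\mathsf T}y : y\text{ is an extreme direction of }(\operatorname{cone}Y_{Out})^+,\ c^{\mathsf T}y=1\}$; 2. every element of $\bar T$ is a maximizer of (D').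 -/

import Mathlib

open scoped Matrix

noncomputable section

namespace UnboundedCVOP

/-! ### Preliminaries on `ℝ^q` -/

/-- The `ℓ₁` norm on `ℝ^q`. -/
def l1Norm {q : ℕ} (x : Fin q → ℝ) : ℝ := ∑ i, |x i|

/-- The closed `ℓ₁` unit ball around the origin. -/
def l1Ball (q : ℕ) : Set (Fin q → ℝ) := {x | l1Norm x ≤ 1}

/-- The convex conic hull of a set, with `cone ∅ = {0}`. -/
def cone {q : ℕ} (A : Set (Fin q → ℝ)) : Set (Fin q → ℝ) :=
  (PointedCone.hull ℝ A : Set (Fin q → ℝ))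

/-- The positive dual cone `A⁺`. -/
def posDual {q : ℕ} (A : Set (Fin q → ℝ)) : Set (Fin q → ℝ) :=
  {z | ∀ a ∈ A, 0 ≤ z ⬝ᵥ a}

/-- The recession cone `A_∞`. -/
def recCone {q : ℕ} (A : Set (Fin q → ℝ)) : Set (Fin q → ℝ) :=
  {d | ∀ y ∈ A, ∀ α : ℝ, 0 ≤ α → y + α • d ∈ A}

/-- `y` is an extreme direction of the cone `C`: a nonzero element of `C` that is not a convex
combination of elements of `C \ cone {y}`. -/
def IsExtremeDirection {q : ℕ} (C : Set (Fin q → ℝ)) (y : Fin q → ℝ) : Prop :=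
  y ∈ C ∧ y ≠ 0 ∧ y ∉ convexHull ℝ (C \ cone {y})

/-- `A` is polyhedral convex: a finite intersection of closed halfspaces. -/
def IsPolyhedral {q : ℕ} (A : Set (Fin q → ℝ)) : Prop :=
  ∃ (r : ℕ) (w : Fin r → Fin q → ℝ) (γ : Fin r → ℝ), (∀ i, w i ≠ 0) ∧
    A = ⋂ i, {y | γ i ≤ w i ⬝ᵥ y}

/-- `C` is a convex cone: `α C ⊆ C` for `α > 0` and `C + C ⊆ C`. -/
def IsConvexCone {q : ℕ} (C : Set (Fin q → ℝ)) : Prop :=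
  (∀ α : ℝ, 0 < α → ∀ y ∈ C, α • y ∈ C) ∧ ∀ y ∈ C, ∀ z ∈ C, y + z ∈ C

/-- A cone is pointed if it contains no line through the origin. -/
def IsPointed {q : ℕ} (C : Set (Fin q → ℝ)) : Prop :=
  ∀ d ∈ C, -d ∈ C → d = 0

/-- A cone is non-trivial if `{0} ⊊ C ⊊ ℝ^q`. -/
def IsNontrivialCone {q : ℕ} (C : Set (Fin q → ℝ)) : Prop :=
  {0} ⊂ C ∧ C ⊂ Set.univ

/-- The relation `v ≤_C w`. -/
def LeCone {q : ℕ} (C : Set (Fin q → ℝ)) (v w : Fin q → ℝ) : Prop := w - v ∈ C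

/-! ### The convex vector optimization problem -/

/-- The data of the problem: minimize `Γ x` with respect to `≤_C` subject to `x ∈ X`.
Only the values of `Γ` on `X` are ever used. -/
structure Problem (n q : ℕ) where
  C : Set (Fin q → ℝ)
  X : Set (Fin n → ℝ)
  Γ : (Fin n → ℝ) → (Fin q → ℝ)

namespace Problem

variable {n q : ℕ} (P : Problem n q)

/-- `Γ` is `C`-convex on `X`. -/
def IsCConvex : Prop :=
  ∀ x ∈ P.X, ∀ y ∈ P.X, ∀ α : ℝ, 0 ≤ α → α ≤ 1 →
    LeCone P.C (P.Γ (α • x + (1 - α) • y)) (α • P.Γ x + (1 - α) • P.Γ y)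

/-- The standing assumptions, including polyhedrality of the ordering cone. -/
structure Assumptions : Prop where
  X_closed : IsClosed P.X
  X_convex : Convex ℝ P.X
  X_solid : (interior P.X).Nonempty
  C_closed : IsClosed P.C
  C_cone : IsConvexCone P.C
  C_nontrivial : IsNontrivialCone P.C
  C_pointed : IsPointed P.C
  C_solid : (interior P.C).Nonempty
  C_polyhedral : IsPolyhedral P.C
  Γ_continuous : ContinuousOn P.Γ P.X
  Γ_convex : P.IsCConvex

/-! ### Scalarizations -/

/-- `x` is an optimal solution of the weighted sum scalarization `P₁(w)`. -/
def IsOptP1 (w : Fin q → ℝ) (x : Fin n → ℝ) : Prop :=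
  x ∈ P.X ∧ ∀ x' ∈ P.X, w ⬝ᵥ P.Γ x ≤ w ⬝ᵥ P.Γ x'

/-- `P₁(w)` is unbounded. -/
def UnboundedP1 (w : Fin q → ℝ) : Prop :=
  ∀ M : ℝ, ∃ x ∈ P.X, w ⬝ᵥ P.Γ x < M

/-- `(x, z)` is feasible for the Pascoletti-Serafini scalarization `P₂(v, d)`. -/
def FeasP2 (v d : Fin q → ℝ) (x : Fin n → ℝ) (z : ℝ) : Prop :=
  x ∈ P.X ∧ LeCone P.C (P.Γ x - v - z • d) 0

/-- `(x, z)` is an optimal solution of `P₂(v, d)` (maximize `z`). -/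
def IsOptP2 (v d : Fin q → ℝ) (x : Fin n → ℝ) (z : ℝ) : Prop :=
  P.FeasP2 v d x z ∧ ∀ x' z', P.FeasP2 v d x' z' → z' ≤ z

/-- `P₂(v, d)` is unbounded. -/
def UnboundedP2 (v d : Fin q → ℝ) : Prop :=
  ∀ M : ℝ, ∃ x z, P.FeasP2 v d x z ∧ M < z

/-- The objective of the Lagrangian dual `D₂(v, d)`, namely `sup_{x ∈ X} {-wᵀ Γ x} + wᵀ v`. -/
def objD2 (v w : Fin q → ℝ) : EReal :=
  (⨆ x ∈ P.X, ((-(w ⬝ᵥ P.Γ x) : ℝ) : EReal)) + ((w ⬝ᵥ v : ℝ) : EReal)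

/-- `w` is feasible for `D₂(v, d)`. -/
def FeasD2 (d w : Fin q → ℝ) : Prop :=
  w ⬝ᵥ d = -1 ∧ w ∈ posDual P.C

/-- `w` is an optimal solution of `D₂(v, d)`. -/
def IsOptD2 (v d w : Fin q → ℝ) : Prop :=
  P.FeasD2 d w ∧ ∀ w', P.FeasD2 d w' → P.objD2 v w ≤ P.objD2 v w'

end Problem

/-! ### The algorithm computing the outer approximation -/

/-- Control states. The for-loops over `R*` and over `-R` carry the set of directions that
have not been treated yet. -/
inductive Phase (q : ℕ) where
  | feasibility
  | infeasible
  | boundedness (todo : Set (Fin q → ℝ))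
  | boundednessCheck
  | lineality (todo : Set (Fin q → ℝ))
  | outer
  | loop
  | finished

/-- The variables of the algorithm. -/
structure AlgState (n q : ℕ) where
  phase : Phase q
  YIn : Set (Fin q → ℝ)
  Chat : Set (Fin q → ℝ)
  P0 : Set (Fin q → ℝ)
  Xbar : Set (Fin n → ℝ)
  b : Bool
  Tbar : Set (Fin q → ℝ)
  v : Fin q → ℝ
  YOut : Set (Fin q → ℝ)

/-- The halfspace `{y | wᵀ (y - p) ≥ 0}`. -/
def halfspace {q : ℕ} (w p : Fin q → ℝ) : Set (Fin q → ℝ) :=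
  {y | 0 ≤ w ⬝ᵥ (y - p)}

/-- The nonzero vertices of `(P₀)_∞ ∩ B₁(0)`. -/
def outerDirections {q : ℕ} (P0 : Set (Fin q → ℝ)) : Set (Fin q → ℝ) :=
  Set.extremePoints ℝ (recCone P0 ∩ l1Ball q) \ {0}

/-- The state after initialization (`v` and `YOut` are only assigned later). -/
def initState (n : ℕ) {q : ℕ} (R : Finset (Fin q → ℝ)) : AlgState n q where
  phase := .feasibility
  YIn := R
  Chat := ∅
  P0 := Set.univ
  Xbar := ∅
  b := true
  Tbar := ∅
  v := 0
  YOut := ∅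

/-- The update performed when `x` and `w` are optimal solutions of `P₂(v, d)` and `D₂(v, d)`. -/
def AlgState.cut {n q : ℕ} (s : AlgState n q) (P : Problem n q) (c : Fin q → ℝ)
    (T : Matrix (Fin q) (Fin q) ℝ) (x : Fin n → ℝ) (w : Fin q → ℝ) : AlgState n q :=
  { s with
    Xbar := s.Xbar ∪ {x}
    Tbar := s.Tbar ∪ {Tᵀ *ᵥ ((c ⬝ᵥ w)⁻¹ • w)}
    P0 := s.P0 ∩ halfspace w (P.Γ x) }

/-- One step of the algorithm for the problem `P`, with normalizing direction `c`, matrix `T`,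
generators `R` of `C` and `Rstar` of `C⁺`, and tolerance `δ`. All choices (optimal solutions,
order of treatment, nearest inner direction, `λ ∈ (0, 1)`) are left free. -/
inductive AlgStep {n q : ℕ} (P : Problem n q) (c : Fin q → ℝ) (T : Matrix (Fin q) (Fin q) ℝ)
    (R Rstar : Finset (Fin q → ℝ)) (δ : ℝ) : AlgState n q → AlgState n q → Prop
  /-- Feasibility check: the problem is infeasible, stop without output. -/
  | infeasible (s : AlgState n q) (hs : s.phase = .feasibility) (hX : P.X = ∅) :
      AlgStep P c T R Rstar δ s { s with phase := .infeasible }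
  /-- Feasibility check: a feasible point is found and `v` is set. -/
  | feasible (s : AlgState n q) (hs : s.phase = .feasibility)
      (x₀ : Fin n → ℝ) (hx₀ : x₀ ∈ P.X) :
      AlgStep P c T R Rstar δ s
        { s with phase := .boundedness Rstar, v := P.Γ x₀ + ∑ d ∈ R, d }
  /-- Boundedness check: `P₁(z)` is unbounded. -/
  | boundednessUnb (s : AlgState n q) (todo : Set (Fin q → ℝ))
      (hs : s.phase = .boundedness todo) (z : Fin q → ℝ) (hz : z ∈ todo)
      (hu : P.UnboundedP1 z) :
      AlgStep P c T R Rstar δ s { s with phase := .boundedness (todo \ {z}), b := false }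
  /-- Boundedness check: `P₁(z)` has the optimal solution `x`. -/
  | boundednessOpt (s : AlgState n q) (todo : Set (Fin q → ℝ))
      (hs : s.phase = .boundedness todo) (z : Fin q → ℝ) (hz : z ∈ todo)
      (x : Fin n → ℝ) (hx : P.IsOptP1 z x) :
      AlgStep P c T R Rstar δ s
        { s with
          phase := .boundedness (todo \ {z})
          Xbar := s.Xbar ∪ {x}
          Tbar := s.Tbar ∪ {Tᵀ *ᵥ z}
          P0 := s.P0 ∩ halfspace z (P.Γ x) }
  /-- End of the for-loop over `R*`. -/
  | boundednessEnd (s : AlgState n q) (hs : s.phase = .boundedness ∅) :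
      AlgStep P c T R Rstar δ s { s with phase := .boundednessCheck }
  /-- The problem is bounded: return `R` as the set of outer directions and stop. -/
  | stopBounded (s : AlgState n q) (hs : s.phase = .boundednessCheck) (hb : s.b = true) :
      AlgStep P c T R Rstar δ s { s with phase := .finished, YOut := R }
  /-- The problem is unbounded: start the for-loop over `-R`. -/
  | continueUnbounded (s : AlgState n q) (hs : s.phase = .boundednessCheck)
      (hb : s.b = false) :
      AlgStep P c T R Rstar δ s { s with phase := .lineality {d | -d ∈ R} }
  /-- Lineality check: `P₂(v, d)` is unbounded. -/
  | linealityUnb (s : AlgState n q) (todo : Set (Fin q → ℝ))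
      (hs : s.phase = .lineality todo) (d : Fin q → ℝ) (hd : d ∈ todo)
      (hu : P.UnboundedP2 s.v d) :
      AlgStep P c T R Rstar δ s
        { s with phase := .lineality (todo \ {d}), YIn := s.YIn ∪ {d} }
  /-- Lineality check: `P₂(v, d)` and `D₂(v, d)` have optimal solutions. -/
  | linealityOpt (s : AlgState n q) (todo : Set (Fin q → ℝ))
      (hs : s.phase = .lineality todo) (d : Fin q → ℝ) (hd : d ∈ todo)
      (x : Fin n → ℝ) (z : ℝ) (hx : P.IsOptP2 s.v d x z)
      (w : Fin q → ℝ) (hw : P.IsOptD2 s.v d w) :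
      AlgStep P c T R Rstar δ s
        { s.cut P c T x w with phase := .lineality (todo \ {d}) }
  /-- End of the for-loop over `-R`. -/
  | linealityEnd (s : AlgState n q) (hs : s.phase = .lineality ∅) :
      AlgStep P c T R Rstar δ s { s with phase := .outer }
  /-- Compute the outer directions and enter the while-loop. -/
  | computeOuter (s : AlgState n q) (hs : s.phase = .outer) :
      AlgStep P c T R Rstar δ s { s with phase := .loop, YOut := outerDirections s.P0 }
  /-- While-loop: the outer direction `d` is within `δ` of its nearest inner direction `r`. -/
  | loopClose (s : AlgState n q) (hs : s.phase = .loop)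
      (d : Fin q → ℝ) (hd : d ∈ s.YOut \ (s.YIn ∪ s.Chat))
      (r : Fin q → ℝ) (hr : r ∈ s.YIn) (hmin : ∀ r' ∈ s.YIn, l1Norm (d - r) ≤ l1Norm (d - r'))
      (hδ : l1Norm (d - r) ≤ δ) :
      AlgStep P c T R Rstar δ s { s with Chat := s.Chat ∪ {d} }
  /-- While-loop: `d` is further than `δ` from `r` and `P₂(v, e)` is unbounded for the combination
  `e = λ d + (1 - λ) r`. The scalarization is only defined for a nonzero direction `e`. -/
  | loopUnb (s : AlgState n q) (hs : s.phase = .loop)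
      (d : Fin q → ℝ) (hd : d ∈ s.YOut \ (s.YIn ∪ s.Chat))
      (r : Fin q → ℝ) (hr : r ∈ s.YIn) (hmin : ∀ r' ∈ s.YIn, l1Norm (d - r) ≤ l1Norm (d - r'))
      (hδ : δ < l1Norm (d - r))
      (lam : ℝ) (hlam0 : 0 < lam) (hlam1 : lam < 1)
      (e : Fin q → ℝ) (he : e = lam • d + (1 - lam) • r) (he0 : e ≠ 0)
      (hu : P.UnboundedP2 s.v e) :
      AlgStep P c T R Rstar δ s { s with YIn := s.YIn ∪ {(l1Norm e)⁻¹ • e} }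
  /-- While-loop: `d` is further than `δ` from `r` and `P₂(v, e)`, `D₂(v, e)` have optimal
  solutions. -/
  | loopOpt (s : AlgState n q) (hs : s.phase = .loop)
      (d : Fin q → ℝ) (hd : d ∈ s.YOut \ (s.YIn ∪ s.Chat))
      (r : Fin q → ℝ) (hr : r ∈ s.YIn) (hmin : ∀ r' ∈ s.YIn, l1Norm (d - r) ≤ l1Norm (d - r'))
      (hδ : δ < l1Norm (d - r))
      (lam : ℝ) (hlam0 : 0 < lam) (hlam1 : lam < 1)
      (e : Fin q → ℝ) (he : e = lam • d + (1 - lam) • r) (he0 : e ≠ 0)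
      (x : Fin n → ℝ) (z : ℝ) (hx : P.IsOptP2 s.v e x z)
      (w : Fin q → ℝ) (hw : P.IsOptD2 s.v e w) :
      AlgStep P c T R Rstar δ s
        { s.cut P c T x w with YOut := outerDirections (s.cut P c T x w).P0 }
  /-- End of the while-loop: return. -/
  | loopEnd (s : AlgState n q) (hs : s.phase = .loop)
      (hempty : s.YOut \ (s.YIn ∪ s.Chat) = ∅) :
      AlgStep P c T R Rstar δ s { s with phase := .finished }

/-- Some run of the algorithm terminates after finitely many steps and returns the variables
stored in `s`. -/
def AlgReturns {n q : ℕ} (P : Problem n q) (c : Fin q → ℝ) (T : Matrix (Fin q) (Fin q) ℝ)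
    (R Rstar : Finset (Fin q → ℝ)) (δ : ℝ) (s : AlgState n q) : Prop :=
  Relation.ReflTransGen (AlgStep P c T R Rstar δ) (initState n R) s ∧ s.phase = .finished

/-! ### The modified geometric dual problem, with `q = m + 1` -/

/-- `w(t) = ((t₁, …, t_{q-1}, 1) T⁻¹)ᵀ`. -/
def dualWeight {m : ℕ} (T : Matrix (Fin (m + 1)) (Fin (m + 1)) ℝ) (t : Fin (m + 1) → ℝ) :
    Fin (m + 1) → ℝ :=
  Function.update t (Fin.last m) 1 ᵥ* T⁻¹

/-- The dual objective `D*(t) = (t₁, …, t_{q-1}, inf_{x ∈ X} w(t)ᵀ Γ x)`, with values in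
`ℝ^{q-1} × [-∞, ∞]`. -/
def dualObj {n m : ℕ} (P : Problem n (m + 1)) (T : Matrix (Fin (m + 1)) (Fin (m + 1)) ℝ)
    (t : Fin (m + 1) → ℝ) : (Fin m → ℝ) × EReal :=
  (fun i => t i.castSucc, ⨅ x ∈ P.X, ((dualWeight T t ⬝ᵥ P.Γ x : ℝ) : EReal))

/-- The ordering cone `K = {(0, …, 0, k) | k ≥ 0}` of the dual problem. -/
def coneK (m : ℕ) : Set (Fin (m + 1) → ℝ) :=
  {k | (∀ i : Fin m, k i.castSucc = 0) ∧ 0 ≤ k (Fin.last m)}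

/-- The inclusion of `ℝ^q` in `ℝ^{q-1} × [-∞, ∞]`. -/
def extendReal {m : ℕ} (y : Fin (m + 1) → ℝ) : (Fin m → ℝ) × EReal :=
  (fun i => y i.castSucc, (y (Fin.last m) : EReal))

/-- `y` is a `K`-maximal element of `A`: `y ∈ A` and `({y} + K \ {0}) ∩ A = ∅`. As
`-∞ + k = -∞`, the last component of a maximal element is never `-∞`. -/
def IsKMaximal {m : ℕ} (A : Set ((Fin m → ℝ) × EReal)) (y : (Fin m → ℝ) × EReal) : Prop :=
  y ∈ A ∧ ∀ k ∈ coneK m \ {0}, y + extendReal k ∉ A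

/-- The feasible set `{t | w(t) ∈ (cone Y)⁺}` of the modified geometric dual problem. -/
def dualFeasible {m : ℕ} (T : Matrix (Fin (m + 1)) (Fin (m + 1)) ℝ)
    (Y : Set (Fin (m + 1) → ℝ)) : Set (Fin (m + 1) → ℝ) :=
  {t | dualWeight T t ∈ posDual (cone Y)}

/-- `t` is a maximizer of the modified geometric dual problem: maximize `D*(t)` with respect to
`≤_K` subject to `w(t) ∈ (cone Y)⁺`. -/
def IsDualMaximizer {n m : ℕ} (P : Problem n (m + 1))
    (T : Matrix (Fin (m + 1)) (Fin (m + 1)) ℝ) (Y : Set (Fin (m + 1) → ℝ))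
    (t : Fin (m + 1) → ℝ) : Prop :=
  t ∈ dualFeasible T Y ∧ IsKMaximal (dualObj P T '' dualFeasible T Y) (dualObj P T t)

end UnboundedCVOP

end

/-!
Let `W` be the finite set of weights `w`, scaled to `cᵀ w = 1`, with `Tbar = Tᵀ W`.

At termination `(cone YOut)⁺ = W⁺⁺`. If the algorithm stops because every `P₁(z)` is bounded, then
`R* ⊆ W ⊆ C⁺` and both sides are `C⁺`. Otherwise `(P₀)_∞ = W⁺`, and by Krein–Milman the nonzero
vertices of `W⁺ ∩ B₁(0)` have the same dual as `W⁺`. Separating a point from `conv W` inside the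
hyperplane `cᵀ y = 1` shows that the slice of `W⁺⁺` by it is `conv W`, whose points
outside `W` cannot be extreme directions.

Every `w ∈ W` has `P₁(w)` bounded: for an optimal solution of `D₂(v, d)` this holds because its
value is finite, as `v` is a Slater point and so separation from `Γ(X) + C` produces some feasible
weight with finite objective. Finally, the first `q - 1` coordinates of `D*(t)` determine `w(t)`
and hence the last one, so no two elements of the image of `D*` are comparable for `≤_K`, and `t` is
a maximizer as soon as the infimum in `D*(t)` is finite.
-/

namespace UnboundedCVOP

open scoped Pointwise Topology

section DualCone

variable {q : ℕ} {A C W : Set (Fin q → ℝ)} {K : PointedCone ℝ (Fin q → ℝ)} {c w y : Fin q → ℝ}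

lemma subset_cone (A : Set (Fin q → ℝ)) : A ⊆ cone A :=
  PointedCone.subset_hull

lemma coe_dual_flip_dotProductBilin (A : Set (Fin q → ℝ)) :
    (PointedCone.dual (dotProductBilin ℝ ℝ).flip A : Set (Fin q → ℝ)) = posDual A :=
  rfl

lemma posDual_cone (A : Set (Fin q → ℝ)) : posDual (cone A) = posDual A :=
  congrArg SetLike.coe (PointedCone.dual_hull (p := (dotProductBilin ℝ ℝ).flip) A)

lemma posDual_anti (h : A ⊆ C) : posDual C ⊆ posDual A :=
  fun _ hz a ha => hz a (h ha)

lemma subset_posDual_posDual (A : Set (Fin q → ℝ)) : A ⊆ posDual (posDual A) :=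
  fun a ha z hz => dotProduct_comm z a ▸ hz a ha

lemma smul_mem_posDual {a : ℝ} (ha : 0 ≤ a) (hw : w ∈ posDual A) : a • w ∈ posDual A := by
  rw [← coe_dual_flip_dotProductBilin] at hw ⊢
  exact PointedCone.smul_mem _ ha hw

lemma posDual_posDual_eq_posDual (hA : cone A = posDual C) (hAW : A ⊆ W) (hWC : W ⊆ posDual C) :
    posDual (posDual W) = posDual C := by
  refine Set.Subset.antisymm ?_ ?_
  · exact posDual_anti ((subset_posDual_posDual C).trans (posDual_anti hWC))
  · calc posDual C ⊆ posDual (posDual (cone A)) := hA ▸ subset_posDual_posDual _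
      _ = posDual (posDual A) := by rw [posDual_cone]
      _ ⊆ posDual (posDual W) := posDual_anti (posDual_anti hAW)

lemma dotProduct_pos_of_mem_interior (hc : c ∈ interior C) (hw : w ∈ posDual C) (hw0 : w ≠ 0) :
    0 < w ⬝ᵥ c := by
  have hopen : IsOpenMap fun y => w ⬝ᵥ y :=
    (dotProductEquiv ℝ (Fin q) w).isOpenMap_of_finiteDimensional <|
      LinearMap.surjective ((LinearEquiv.map_ne_zero_iff _).2 hw0)
  simpa only [interior_Ici, Set.mem_Ioi] using hopen.mapsTo_interior (t := Set.Ici 0) hw hc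

lemma nonneg_of_forall_le_add_mul {𝕜 : Type*} [Field 𝕜] [LinearOrder 𝕜] [IsStrictOrderedRing 𝕜]
    [Archimedean 𝕜] {a b l : 𝕜} (h : ∀ α, 0 ≤ α → l ≤ a + α * b) : 0 ≤ b := by
  by_contra! hb
  obtain ⟨k, hk⟩ := exists_lt_nsmul (neg_pos.2 hb) (a - l)
  rw [nsmul_eq_mul] at hk
  linarith [h k k.cast_nonneg]

lemma exists_mem_posDual_forall_dotProduct_le (hA : Convex ℝ A) (hint : (interior A).Nonempty)
    (hAK : A + K ⊆ A) {p : Fin q → ℝ} (hp : p ∉ interior A) :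
    ∃ w ∈ posDual (K : Set (Fin q → ℝ)), w ≠ 0 ∧ ∀ y ∈ A, w ⬝ᵥ p ≤ w ⬝ᵥ y := by
  obtain ⟨f, hf0, hf⟩ := geometric_hahn_banach_of_nonempty_interior_point hA hp hint
  obtain ⟨w, hw⟩ := (dotProductEquiv ℝ (Fin q)).surjective (-f : (Fin q → ℝ) →L[ℝ] ℝ).toLinearMap
  have hwf (y : Fin q → ℝ) : w ⬝ᵥ y = -f y := LinearMap.congr_fun hw y
  have hle (y) (hy : y ∈ A) : w ⬝ᵥ p ≤ w ⬝ᵥ y := by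
    simpa only [hwf, neg_le_neg_iff] using hf y hy
  refine ⟨w, fun k hk => ?_, ?_, hle⟩
  · obtain ⟨y, hy⟩ := hint.mono interior_subset
    refine nonneg_of_forall_le_add_mul (a := w ⬝ᵥ y) (l := w ⬝ᵥ p) fun α hα => ?_
    simpa only [dotProduct_add, dotProduct_smul, smul_eq_mul] using
      hle _ (hAK (Set.add_mem_add hy (K.smul_mem hα hk)))
  · rintro rfl
    exact hf0 (ContinuousLinearMap.ext fun y => by simpa using (hwf y).symm)

lemma sum_mem_interior_cone {R : Finset (Fin q → ℝ)}
    (hR : (interior (cone (R : Set (Fin q → ℝ)))).Nonempty) :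
    ∑ r ∈ R, r ∈ interior (cone (R : Set (Fin q → ℝ))) := by
  by_contra hsum
  let K := PointedCone.hull ℝ (R : Set (Fin q → ℝ))
  obtain ⟨w, hwK, hw0, hw⟩ := exists_mem_posDual_forall_dotProduct_le (K := K) K.convex hR
    (by simp [K]) hsum
  have hnonneg : ∀ r ∈ R, 0 ≤ w ⬝ᵥ r := fun r hr => hwK r (subset_cone _ hr)
  have hsum_le : ∑ r ∈ R, w ⬝ᵥ r ≤ 0 := by
    simpa only [dotProduct_sum, dotProduct_zero] using hw 0 K.zero_mem
  have hzero := (Finset.sum_eq_zero_iff_of_nonneg hnonneg).1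
    (hsum_le.antisymm (Finset.sum_nonneg hnonneg))
  have hneg : -w ∈ posDual (cone (R : Set (Fin q → ℝ))) := by
    rw [posDual_cone]
    intro r hr
    rw [neg_dotProduct, hzero r hr, neg_zero]
  obtain ⟨c, hc⟩ := hR
  have hpos := dotProduct_pos_of_mem_interior hc hwK hw0
  have hneg_c := hneg c (interior_subset hc)
  rw [neg_dotProduct] at hneg_c
  linarith

lemma mem_convexHull_of_mem_posDual_posDual (hW : IsClosed (convexHull ℝ W))
    (hWc : ∀ w ∈ W, c ⬝ᵥ w = 1) (hyc : c ⬝ᵥ y = 1) (hy : y ∈ posDual (posDual W)) :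
    y ∈ convexHull ℝ W := by
  by_contra hyW
  obtain ⟨f, u, hfy, hfW⟩ := geometric_hahn_banach_point_closed (convex_convexHull ℝ W) hW hyW
  obtain ⟨v, hv⟩ := (dotProductEquiv ℝ (Fin q)).surjective f.toLinearMap
  have hvf (x : Fin q → ℝ) : v ⬝ᵥ x = f x := LinearMap.congr_fun hv x
  have hvu (x) (hx : c ⬝ᵥ x = 1) : (v - u • c) ⬝ᵥ x = f x - u := by
    rw [sub_dotProduct, smul_dotProduct, hx, hvf, smul_eq_mul, mul_one]
  have hmem : v - u • c ∈ posDual W := fun w hw => by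
    rw [hvu w (hWc w hw)]
    exact sub_nonneg.2 (hfW w (subset_convexHull ℝ W hw)).le
  have hnonneg := hy _ hmem
  rw [dotProduct_comm, hvu y hyc] at hnonneg
  linarith

lemma IsExtremeDirection.mem_of_mem_convexHull (hy : IsExtremeDirection C y) (hWC : W ⊆ C)
    (hWc : ∀ w ∈ W, c ⬝ᵥ w = 1) (hyc : c ⬝ᵥ y = 1) (hyW : y ∈ convexHull ℝ W) : y ∈ W := by
  by_contra hy_notMem
  refine hy.2.2 (convexHull_mono (Set.subset_sdiff.2 ⟨hWC, ?_⟩) hyW)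
  refine Set.disjoint_left.2 fun w hw hwy => hy_notMem ?_
  obtain ⟨⟨a, ha⟩, rfl⟩ := Submodule.mem_span_singleton.1 hwy
  rw [Nonneg.mk_smul] at hw
  have ha1 : a = 1 := by
    simpa only [dotProduct_smul, hyc, smul_eq_mul, mul_one] using hWc _ hw
  rwa [ha1, one_smul] at hw

lemma IsExtremeDirection.mem_of_posDual_posDual (hy : IsExtremeDirection (posDual (posDual W)) y)
    (hW : IsClosed (convexHull ℝ W)) (hWc : ∀ w ∈ W, c ⬝ᵥ w = 1) (hyc : c ⬝ᵥ y = 1) : y ∈ W :=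
  hy.mem_of_mem_convexHull (subset_posDual_posDual W) hWc hyc
    (mem_convexHull_of_mem_posDual_posDual hW hWc hyc hy.1)

end DualCone

section OuterDirections

variable {q : ℕ} {K : PointedCone ℝ (Fin q → ℝ)} {B W P0 : Set (Fin q → ℝ)}

lemma l1Ball_eq_preimage_closedBall (q : ℕ) :
    l1Ball q = (PiLp.continuousLinearEquiv 1 ℝ fun _ : Fin q => ℝ).symm ⁻¹'
      Metric.closedBall 0 1 := by
  ext x
  simp [l1Ball, l1Norm, PiLp.norm_eq_of_L1]

lemma convex_l1Ball (q : ℕ) : Convex ℝ (l1Ball q) := by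
  rw [l1Ball_eq_preimage_closedBall]
  exact (convex_closedBall _ _).linear_preimage
    (PiLp.continuousLinearEquiv 1 ℝ fun _ : Fin q => ℝ).symm.toLinearMap

lemma isCompact_l1Ball (q : ℕ) : IsCompact (l1Ball q) := by
  rw [l1Ball_eq_preimage_closedBall]
  exact (PiLp.continuousLinearEquiv 1 ℝ fun _ : Fin q => ℝ).symm.toHomeomorph.isCompact_preimage.2
    (isCompact_closedBall _ _)

lemma l1Ball_mem_nhds_zero (q : ℕ) : l1Ball q ∈ 𝓝 0 := by
  rw [l1Ball_eq_preimage_closedBall]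
  refine (ContinuousLinearEquiv.continuous _).continuousAt.preimage_mem_nhds ?_
  rw [map_zero]
  exact Metric.closedBall_mem_nhds 0 one_pos

lemma posDual_inter_of_mem_nhds_zero (hB : B ∈ 𝓝 0) : posDual (K ∩ B) = posDual K := by
  refine Set.Subset.antisymm (fun z hz d hd => ?_) (posDual_anti Set.inter_subset_left)
  have hcont : ContinuousAt (fun t : ℝ => t • d) 0 := by fun_prop
  have hev : ∀ᶠ t : ℝ in 𝓝 0, t • d ∈ B := hcont.preimage_mem_nhds (by rwa [zero_smul])
  obtain ⟨t, htB, ht⟩ := ((hev.filter_mono nhdsWithin_le_nhds).and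
    (self_mem_nhdsWithin (a := (0 : ℝ)) (s := Set.Ioi 0))).exists
  have hnonneg := hz (t • d) ⟨K.smul_mem (le_of_lt ht) hd, htB⟩
  rw [dotProduct_smul] at hnonneg
  exact nonneg_of_mul_nonneg_right hnonneg ht

lemma posDual_extremePoints_diff_zero {S : Set (Fin q → ℝ)} (hS : IsCompact S)
    (hconv : Convex ℝ S) : posDual (S.extremePoints ℝ \ {0}) = posDual S := by
  refine Set.Subset.antisymm (fun z hz => ?_)
    (posDual_anti (Set.sdiff_subset.trans extremePoints_subset))
  have hext : S.extremePoints ℝ ⊆ posDual {z} := by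
    rintro y hy _ rfl
    rw [dotProduct_comm]
    obtain rfl | hy0 := eq_or_ne y 0
    · rw [dotProduct_zero]
    · exact hz y ⟨hy, hy0⟩
  have hsub : S ⊆ posDual {z} := by
    rw [← closure_convexHull_extremePoints hS hconv, ← coe_dual_flip_dotProductBilin]
    exact closure_minimal (convexHull_min hext (PointedCone.convex _))
      (PointedCone.isClosed_dual fun x => LinearMap.continuous_of_finiteDimensional _)
  exact fun y hy => dotProduct_comm z y ▸ hsub hy z rfl

lemma posDual_outerDirections (h : recCone P0 = posDual W) :
    posDual (outerDirections P0) = posDual (posDual W) := by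
  let K := PointedCone.dual (dotProductBilin ℝ ℝ).flip W
  have hK : IsClosed (K : Set (Fin q → ℝ)) :=
    PointedCone.isClosed_dual fun x => LinearMap.continuous_of_finiteDimensional _
  rw [outerDirections, h, ← coe_dual_flip_dotProductBilin W,
    posDual_extremePoints_diff_zero ((isCompact_l1Ball q).inter_left hK)
      (K.convex.inter (convex_l1Ball q)),
    posDual_inter_of_mem_nhds_zero (l1Ball_mem_nhds_zero q)]

end OuterDirections

section Halfspace

variable {q : ℕ} {F : Set ((Fin q → ℝ) × (Fin q → ℝ))}

lemma halfspace_smul {a : ℝ} (ha : 0 < a) (w p : Fin q → ℝ) :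
    halfspace (a • w) p = halfspace w p := by
  ext y
  simp only [halfspace, Set.mem_ofPred_eq, smul_dotProduct, smul_eq_mul, ha,
    mul_nonneg_iff_of_pos_left]

lemma nonempty_biInter_halfspace (hF : F.Finite) {c : Fin q → ℝ} (hc : ∀ p ∈ F, 0 < p.1 ⬝ᵥ c) :
    (⋂ p ∈ F, halfspace p.1 p.2).Nonempty := by
  have hev : ∀ᶠ t : ℝ in Filter.atTop, ∀ p ∈ F, p.1 ⬝ᵥ p.2 ≤ t * (p.1 ⬝ᵥ c) :=
    (Filter.eventually_all_finite hF).2 fun p hp =>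
      (Filter.tendsto_id.atTop_mul_const (hc p hp)).eventually_ge_atTop _
  obtain ⟨t, ht⟩ := hev.exists
  refine ⟨t • c, Set.mem_iInter₂.2 fun p hp => ?_⟩
  simpa only [halfspace, Set.mem_ofPred_eq, dotProduct_sub, dotProduct_smul, smul_eq_mul,
    sub_nonneg] using ht p hp

lemma recCone_biInter_halfspace (hF : (⋂ p ∈ F, halfspace p.1 p.2).Nonempty) :
    recCone (⋂ p ∈ F, halfspace p.1 p.2) = posDual (Prod.fst '' F) := by
  have hadd (w p y d : Fin q → ℝ) (α : ℝ) :
      w ⬝ᵥ (y + α • d - p) = w ⬝ᵥ (y - p) + α * (w ⬝ᵥ d) := by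
    rw [add_sub_right_comm, dotProduct_add, dotProduct_smul, smul_eq_mul]
  ext d
  simp only [recCone, posDual, halfspace, Set.mem_iInter, Set.mem_ofPred_eq, hadd,
    Set.forall_mem_image, dotProduct_comm d]
  constructor
  · intro hd p hp
    obtain ⟨y, hy⟩ := hF
    exact nonneg_of_forall_le_add_mul fun α hα => hd y (Set.mem_iInter₂.1 hy) α hα p hp
  · exact fun hd y hy α hα p hp => add_nonneg (hy p hp) (mul_nonneg hα (hd hp))

end Halfspace

namespace Problem

variable {n q : ℕ} {P : Problem n q} {K : PointedCone ℝ (Fin q → ℝ)} {v d w : Fin q → ℝ}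

/-- The set `Γ(X) + C` of all points dominated by an attained value (the upper image of the
problem, without the closure): `P₂(v, d)` asks how far one can go from `v` along `d` inside it. -/
def upperImage (P : Problem n q) : Set (Fin q → ℝ) := P.Γ '' P.X + P.C

/-- `v` lies strictly above an attained value, which is Slater's condition for every `P₂(v, d)`. -/
def IsSlaterPoint (P : Problem n q) (v : Fin q → ℝ) : Prop :=
  ∃ x ∈ P.X, v - P.Γ x ∈ interior P.C

/-- The objective of `P₁(w)` is bounded below on `X`; the infimum need not be attained. -/
def BoundedP1 (P : Problem n q) (w : Fin q → ℝ) : Prop :=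
  BddBelow ((fun x => w ⬝ᵥ P.Γ x) '' P.X)

lemma mem_upperImage {y : Fin q → ℝ} : y ∈ P.upperImage ↔ ∃ x ∈ P.X, y - P.Γ x ∈ P.C := by
  simp only [upperImage, Set.mem_add, Set.exists_mem_image, ← eq_sub_iff_add_eq',
    exists_eq_right]

lemma exists_feasP2_iff {z : ℝ} : (∃ x, P.FeasP2 v d x z) ↔ v + z • d ∈ P.upperImage := by
  have hsub (x : Fin n → ℝ) : 0 - (P.Γ x - v - z • d) = v + z • d - P.Γ x := by abel
  simp only [FeasP2, LeCone, mem_upperImage, hsub]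

lemma convex_upperImage (hX : Convex ℝ P.X) (hΓ : P.IsCConvex) (hK : (K : Set (Fin q → ℝ)) = P.C) :
    Convex ℝ P.upperImage := by
  intro y hy y' hy' a b ha hb hab
  simp only [IsCConvex, LeCone, mem_upperImage, ← hK, SetLike.mem_coe] at hy hy' hΓ ⊢
  obtain ⟨x, hx, hy⟩ := hy
  obtain ⟨x', hx', hy'⟩ := hy'
  obtain rfl : b = 1 - a := by linarith
  refine ⟨a • x + (1 - a) • x', hX hx hx' ha hb hab, ?_⟩
  convert K.add_mem (hΓ x hx x' hx' a ha (by linarith))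
    (K.add_mem (K.smul_mem ha hy) (K.smul_mem hb hy')) using 1
  module

lemma BoundedP1.smul (h : P.BoundedP1 w) {a : ℝ} (ha : 0 ≤ a) : P.BoundedP1 (a • w) := by
  obtain ⟨β, hβ⟩ := h
  refine ⟨a * β, Set.forall_mem_image.2 fun x hx => ?_⟩
  rw [smul_dotProduct, smul_eq_mul]
  exact mul_le_mul_of_nonneg_left (hβ ⟨x, hx, rfl⟩) ha

lemma IsOptP1.boundedP1 {x : Fin n → ℝ} (h : P.IsOptP1 w x) : P.BoundedP1 w :=
  ⟨w ⬝ᵥ P.Γ x, Set.forall_mem_image.2 h.2⟩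

lemma objD2_lt_top_iff : P.objD2 v w < ⊤ ↔ P.BoundedP1 w := by
  constructor
  · intro h
    have hsup : (⨆ x ∈ P.X, ((-(w ⬝ᵥ P.Γ x) : ℝ) : EReal)) ≠ ⊤ := fun htop => by
      rw [objD2, htop, EReal.top_add_coe] at h
      exact h.ne rfl
    refine ⟨-(⨆ x ∈ P.X, ((-(w ⬝ᵥ P.Γ x) : ℝ) : EReal)).toReal,
      Set.forall_mem_image.2 fun x hx => neg_le.1 (EReal.coe_le_coe_iff.1 ?_)⟩
    exact (le_iSup₂ (f := fun x _ => ((-(w ⬝ᵥ P.Γ x) : ℝ) : EReal)) x hx).trans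
      (EReal.le_coe_toReal hsup)
  · rintro ⟨β, hβ⟩
    calc P.objD2 v w ≤ ((-β : ℝ) : EReal) + ((w ⬝ᵥ v : ℝ) : EReal) :=
          add_le_add_left (iSup₂_le fun x hx =>
            EReal.coe_le_coe_iff.2 (neg_le_neg (hβ ⟨x, hx, rfl⟩))) _
      _ < ⊤ := EReal.coe_lt_top _

lemma isSlaterPoint_add_sum {R : Finset (Fin q → ℝ)} (hR : cone (R : Set (Fin q → ℝ)) = P.C)
    (hC : (interior P.C).Nonempty) {x : Fin n → ℝ} (hx : x ∈ P.X) :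
    P.IsSlaterPoint (P.Γ x + ∑ d ∈ R, d) := by
  refine ⟨x, hx, ?_⟩
  rw [add_sub_cancel_left, ← hR]
  exact sum_mem_interior_cone (hR ▸ hC)

lemma IsSlaterPoint.mem_interior_upperImage (hv : P.IsSlaterPoint v) :
    v ∈ interior P.upperImage := by
  obtain ⟨x, hx, hvx⟩ := hv
  exact subset_interior_add_right ⟨P.Γ x, ⟨x, hx, rfl⟩, _, hvx, add_sub_cancel _ _⟩

lemma IsSlaterPoint.exists_feasD2_boundedP1 (hX : Convex ℝ P.X) (hΓ : P.IsCConvex)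
    (hK : (K : Set (Fin q → ℝ)) = P.C) (hv : P.IsSlaterPoint v) {x : Fin n → ℝ} {z : ℝ}
    (hx : P.IsOptP2 v d x z) : ∃ w, P.FeasD2 d w ∧ P.BoundedP1 w := by
  have hvint := hv.mem_interior_upperImage
  obtain ⟨x₀, hx₀, hvx₀⟩ := hv
  have hz : 0 ≤ z := hx.2 x₀ 0 ⟨hx₀, by simpa [LeCone] using interior_subset hvx₀⟩
  have hout : v + (z + 1) • d ∉ P.upperImage := fun h => by
    obtain ⟨x', hx'⟩ := exists_feasP2_iff.2 h
    linarith [hx.2 x' _ hx']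
  have hadd : P.upperImage + K ⊆ P.upperImage := by simp [upperImage, ← hK, add_assoc]
  obtain ⟨g, hgK, hg0, hg⟩ := exists_mem_posDual_forall_dotProduct_le
    (convex_upperImage hX hΓ hK) ⟨v, hvint⟩ hadd (fun h => hout (interior_subset h))
  have hgΓ (x) (hx : x ∈ P.X) : g ⬝ᵥ (v + (z + 1) • d) ≤ g ⬝ᵥ P.Γ x :=
    hg _ (mem_upperImage.2 ⟨x, hx, by simp [← hK]⟩)
  have hgd : g ⬝ᵥ d < 0 := by
    have hpos := dotProduct_pos_of_mem_interior hvx₀ (hK ▸ hgK) hg0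
    have hle := hgΓ x₀ hx₀
    rw [dotProduct_sub] at hpos
    rw [dotProduct_add, dotProduct_smul, smul_eq_mul] at hle
    exact (pos_iff_neg_of_mul_neg (by linarith : (z + 1) * (g ⬝ᵥ d) < 0)).1 (by linarith)
  have hinv : 0 ≤ (-(g ⬝ᵥ d))⁻¹ := inv_nonneg.2 (neg_nonneg.2 hgd.le)
  refine ⟨(-(g ⬝ᵥ d))⁻¹ • g, ⟨?_, smul_mem_posDual hinv (hK ▸ hgK)⟩, BoundedP1.smul ?_ hinv⟩
  · rw [smul_dotProduct, smul_eq_mul, inv_neg, neg_mul, inv_mul_cancel₀ hgd.ne]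
  · exact ⟨_, Set.forall_mem_image.2 hgΓ⟩

lemma IsOptD2.boundedP1 (hX : Convex ℝ P.X) (hΓ : P.IsCConvex)
    (hK : (K : Set (Fin q → ℝ)) = P.C) (hv : P.IsSlaterPoint v) {x : Fin n → ℝ} {z : ℝ}
    (hx : P.IsOptP2 v d x z) (hw : P.IsOptD2 v d w) : P.BoundedP1 w := by
  obtain ⟨w', hw', hbdd⟩ := hv.exists_feasD2_boundedP1 hX hΓ hK hx
  exact objD2_lt_top_iff.1 ((hw.2 w' hw').trans_lt (objD2_lt_top_iff.2 hbdd))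

lemma FeasD2.ne_zero (hw : P.FeasD2 d w) : w ≠ 0 := by
  rintro rfl
  simpa using hw.1

end Problem

/-- `w` is an element of `C⁺` normalized by `c` for which `P₁(w)` is bounded: the weights behind
the elements of `Tbar` are of this kind. -/
structure IsBoundedWeight {n q : ℕ} (P : Problem n q) (c w : Fin q → ℝ) : Prop where
  normalized : c ⬝ᵥ w = 1
  mem_posDual : w ∈ posDual P.C
  boundedP1 : P.BoundedP1 w

/-- The pairs `(w, p)` in `F` are the normals and boundary points of the halfspaces that were cut
off so far; `P0` and `Tbar` are the sets stored by the algorithm. The normals are rescaled to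
`cᵀ w = 1`, which does not change the halfspaces. -/
structure IsCutFamily {n q : ℕ} (P : Problem n q) (c : Fin q → ℝ) (T : Matrix (Fin q) (Fin q) ℝ)
    (F : Set ((Fin q → ℝ) × (Fin q → ℝ))) (P0 Tbar : Set (Fin q → ℝ)) : Prop where
  finite : F.Finite
  P0_eq : P0 = ⋂ p ∈ F, halfspace p.1 p.2
  Tbar_eq : Tbar = (fun w => Tᵀ *ᵥ w) '' (Prod.fst '' F)
  isBoundedWeight : ∀ w ∈ Prod.fst '' F, IsBoundedWeight P c w

section CutFamily

variable {n q : ℕ} {P : Problem n q} {c w : Fin q → ℝ} {T : Matrix (Fin q) (Fin q) ℝ}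
  {F : Set ((Fin q → ℝ) × (Fin q → ℝ))} {P0 Tbar : Set (Fin q → ℝ)}

lemma isBoundedWeight_inv_smul (hc : c ∈ interior P.C) (hw : w ∈ posDual P.C) (hw0 : w ≠ 0)
    (hbdd : P.BoundedP1 w) : IsBoundedWeight P c ((c ⬝ᵥ w)⁻¹ • w) := by
  have hcw : 0 < c ⬝ᵥ w := dotProduct_comm w c ▸ dotProduct_pos_of_mem_interior hc hw hw0
  have hinv : 0 ≤ (c ⬝ᵥ w)⁻¹ := (inv_pos.2 hcw).le
  refine ⟨?_, smul_mem_posDual hinv hw, hbdd.smul hinv⟩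
  rw [dotProduct_smul, smul_eq_mul, inv_mul_cancel₀ hcw.ne']

lemma isCutFamily_empty : IsCutFamily P c T ∅ Set.univ ∅ :=
  ⟨Set.finite_empty, by simp, by simp, by simp⟩

lemma IsCutFamily.insert (hF : IsCutFamily P c T F P0 Tbar) (hw : IsBoundedWeight P c w)
    (p : Fin q → ℝ) :
    IsCutFamily P c T (insert (w, p) F) (P0 ∩ halfspace w p) (Tbar ∪ {Tᵀ *ᵥ w}) where
  finite := hF.finite.insert _
  P0_eq := by rw [hF.P0_eq, Set.biInter_insert, Set.inter_comm]
  Tbar_eq := by rw [hF.Tbar_eq, Set.image_insert_eq, Set.image_insert_eq, Set.union_singleton]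
  isBoundedWeight := by
    rw [Set.image_insert_eq]
    exact Set.forall_mem_insert.2 ⟨hw, hF.isBoundedWeight⟩

lemma IsCutFamily.insert_inv_smul (hF : IsCutFamily P c T F P0 Tbar) (hc : c ∈ interior P.C)
    (hw : w ∈ posDual P.C) (hw0 : w ≠ 0) (hbdd : P.BoundedP1 w) (p : Fin q → ℝ) :
    IsCutFamily P c T (Insert.insert ((c ⬝ᵥ w)⁻¹ • w, p) F) (P0 ∩ halfspace w p)
      (Tbar ∪ {Tᵀ *ᵥ ((c ⬝ᵥ w)⁻¹ • w)}) := by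
  have hcw : 0 < c ⬝ᵥ w := dotProduct_comm w c ▸ dotProduct_pos_of_mem_interior hc hw hw0
  have hins := hF.insert (isBoundedWeight_inv_smul hc hw hw0 hbdd) p
  rwa [halfspace_smul (inv_pos.2 hcw)] at hins

lemma IsCutFamily.posDual_outerDirections (hF : IsCutFamily P c T F P0 Tbar) :
    posDual (outerDirections P0) = posDual (posDual (Prod.fst '' F)) := by
  refine UnboundedCVOP.posDual_outerDirections ?_
  rw [hF.P0_eq]
  refine recCone_biInter_halfspace (nonempty_biInter_halfspace hF.finite (c := c) fun p hp => ?_)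
  rw [dotProduct_comm, (hF.isBoundedWeight _ ⟨p, hp, rfl⟩).normalized]
  exact one_pos

end CutFamily

section Run

variable {n q : ℕ} {P : Problem n q} {c : Fin q → ℝ} {T : Matrix (Fin q) (Fin q) ℝ}
  {R Rstar : Finset (Fin q → ℝ)} {δ : ℝ} {s s' : AlgState n q}

/-- The loop invariants of the algorithm, by control state. As long as no `P₁(z)` was found to be
unbounded, every treated `z ∈ R*` has left its trace in `Tbar`. -/
def PhaseInvariant (P : Problem n q) (T : Matrix (Fin q) (Fin q) ℝ) (R Rstar : Finset (Fin q → ℝ))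
    (s : AlgState n q) : Prop :=
  match s.phase with
  | .feasibility | .infeasible => True
  | .boundedness todo => P.IsSlaterPoint s.v ∧ todo ⊆ Rstar ∧
      (s.b = true → ∀ z ∈ Rstar, z ∉ todo → Tᵀ *ᵥ z ∈ s.Tbar)
  | .boundednessCheck => P.IsSlaterPoint s.v ∧ (s.b = true → ∀ z ∈ Rstar, Tᵀ *ᵥ z ∈ s.Tbar)
  | .lineality _ | .outer => P.IsSlaterPoint s.v
  | .loop => P.IsSlaterPoint s.v ∧ s.YOut = outerDirections s.P0
  | .finished => P.IsSlaterPoint s.v ∧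
      (s.YOut = outerDirections s.P0 ∨ s.YOut = R ∧ ∀ z ∈ Rstar, Tᵀ *ᵥ z ∈ s.Tbar)

lemma AlgStep.phaseInvariant (hR : cone (R : Set (Fin q → ℝ)) = P.C)
    (hC : (interior P.C).Nonempty) (hstep : AlgStep P c T R Rstar δ s s')
    (hs : PhaseInvariant P T R Rstar s) : PhaseInvariant P T R Rstar s' := by
  cases hstep with
  | feasible _ x hx =>
    exact ⟨P.isSlaterPoint_add_sum hR hC hx, subset_rfl, fun _ z hz hz' => absurd hz hz'⟩
  | boundednessOpt todo hphase z hz x hx =>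
    simp only [PhaseInvariant, hphase] at hs
    obtain ⟨hv, htodo, hTbar⟩ := hs
    refine ⟨hv, Set.sdiff_subset.trans htodo, fun hb y hy hy_treated => ?_⟩
    obtain rfl | hyz := eq_or_ne y z
    · exact Or.inr rfl
    · exact Or.inl (hTbar hb y hy fun hy' => hy_treated ⟨hy', hyz⟩)
  | boundednessUnb todo hphase z hz hu =>
    simp only [PhaseInvariant, hphase] at hs
    exact ⟨hs.1, Set.sdiff_subset.trans hs.2.1, fun hb => absurd hb Bool.false_ne_true⟩
  | _ => simp_all [PhaseInvariant, AlgState.cut]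

lemma AlgStep.exists_isCutFamily (hX : Convex ℝ P.X) (hΓ : P.IsCConvex) (hc : c ∈ interior P.C)
    (hR : cone (R : Set (Fin q → ℝ)) = P.C)
    (hRstar : (Rstar : Set (Fin q → ℝ)) ⊆ posDual P.C) (hRstar1 : ∀ z ∈ Rstar, c ⬝ᵥ z = 1)
    (hstep : AlgStep P c T R Rstar δ s s') (hs : PhaseInvariant P T R Rstar s)
    (hcut : ∃ F, IsCutFamily P c T F s.P0 s.Tbar) : ∃ F, IsCutFamily P c T F s'.P0 s'.Tbar := by
  obtain ⟨F, hF⟩ := hcut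
  have hopt {d w x z} (hv : P.IsSlaterPoint s.v) (hx : P.IsOptP2 s.v d x z)
      (hw : P.IsOptD2 s.v d w) :
      ∃ F, IsCutFamily P c T F (s.cut P c T x w).P0 (s.cut P c T x w).Tbar :=
    ⟨_, hF.insert_inv_smul hc hw.1.2 hw.1.ne_zero (hw.boundedP1 hX hΓ hR hv hx) _⟩
  cases hstep with
  | boundednessOpt todo hphase z hz x hx =>
    simp only [PhaseInvariant, hphase] at hs
    have hzR : z ∈ Rstar := hs.2.1 hz
    exact ⟨_, hF.insert ⟨hRstar1 z hzR, hRstar hzR, hx.boundedP1⟩ _⟩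
  | linealityOpt todo hphase d hd x z hx w hw =>
    simp only [PhaseInvariant, hphase] at hs
    exact hopt hs hx hw
  | loopOpt hphase d hd r hr hmin hδ lam hlam0 hlam1 e he he0 x z hx w hw =>
    simp only [PhaseInvariant, hphase] at hs
    exact hopt hs.1 hx hw
  | _ => exact ⟨F, hF⟩

lemma AlgReturns.exists_isCutFamily (hX : Convex ℝ P.X) (hΓ : P.IsCConvex)
    (hc : c ∈ interior P.C) (hT : IsUnit T.det) (hR : cone (R : Set (Fin q → ℝ)) = P.C)
    (hRstar : cone (Rstar : Set (Fin q → ℝ)) = posDual P.C) (hRstar1 : ∀ z ∈ Rstar, c ⬝ᵥ z = 1)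
    (hs : AlgReturns P c T R Rstar δ s) :
    P.X.Nonempty ∧ ∃ F, IsCutFamily P c T F s.P0 s.Tbar ∧
      posDual (cone s.YOut) = posDual (posDual (Prod.fst '' F)) := by
  obtain ⟨hrun, hfinished⟩ := hs
  have hRstar_sub := (subset_cone (Rstar : Set (Fin q → ℝ))).trans hRstar.subset
  obtain ⟨hphase, F, hF⟩ : PhaseInvariant P T R Rstar s ∧
      ∃ F, IsCutFamily P c T F s.P0 s.Tbar := by
    clear hfinished
    induction hrun with
    | refl => exact ⟨trivial, ∅, isCutFamily_empty⟩
    | tail _ hstep ih =>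
      exact ⟨hstep.phaseInvariant hR ⟨c, hc⟩ ih.1,
        hstep.exists_isCutFamily hX hΓ hc hR hRstar_sub hRstar1 ih.1 ih.2⟩
  simp only [PhaseInvariant, hfinished] at hphase
  obtain ⟨⟨x, hx, -⟩, hYOut | ⟨hYOut, hTbar⟩⟩ := hphase
  · exact ⟨⟨x, hx⟩, F, hF, by rw [posDual_cone, hYOut, hF.posDual_outerDirections]⟩
  · refine ⟨⟨x, hx⟩, F, hF, ?_⟩
    have hinj : Function.Injective fun w => Tᵀ *ᵥ w :=
      Matrix.mulVec_injective_of_det_ne_zero (by simpa using hT.ne_zero)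
    have hRstarF : (Rstar : Set (Fin q → ℝ)) ⊆ Prod.fst '' F := fun z hz =>
      hinj.mem_set_image.1 (hF.Tbar_eq ▸ hTbar z hz)
    rw [hYOut, hR]
    exact (posDual_posDual_eq_posDual hRstar hRstarF
      fun w hw => (hF.isBoundedWeight w hw).mem_posDual).symm

end Run

section GeometricDual

variable {n m : ℕ} {P : Problem n (m + 1)} {T : Matrix (Fin (m + 1)) (Fin (m + 1)) ℝ}
  {Y : Set (Fin (m + 1) → ℝ)} {t t' : Fin (m + 1) → ℝ}

lemma dualWeight_transpose_mulVec (hT : IsUnit T.det) {w : Fin (m + 1) → ℝ}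
    (hw : (Tᵀ *ᵥ w) (Fin.last m) = 1) : dualWeight T (Tᵀ *ᵥ w) = w := by
  rw [dualWeight, ← hw, Function.update_eq_self, Matrix.mulVec_transpose, Matrix.vecMul_vecMul,
    Matrix.mul_nonsing_inv _ hT, Matrix.vecMul_one]

lemma dualObj_eq_of_fst_eq (h : (dualObj P T t).1 = (dualObj P T t').1) :
    dualObj P T t = dualObj P T t' := by
  have hupdate : Function.update t (Fin.last m) 1 = Function.update t' (Fin.last m) 1 := by
    refine funext (Fin.lastCases (by simp) fun i => ?_)
    simpa [dualObj] using congrFun h i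
  rw [Prod.ext_iff]
  exact ⟨h, by simp only [dualObj, dualWeight, hupdate]⟩

lemma add_extendReal_ne {y : (Fin m → ℝ) × EReal} (hbot : y.2 ≠ ⊥) (htop : y.2 ≠ ⊤)
    {k : Fin (m + 1) → ℝ} (hk : k ∈ coneK m \ {0}) : y + extendReal k ≠ y := by
  intro h
  refine hk.2 (funext (Fin.lastCases ?_ hk.1.1))
  have hlast : y.2 + (k (Fin.last m) : EReal) = y.2 := congrArg Prod.snd h
  lift y.2 to ℝ using ⟨htop, hbot⟩ with r
  simpa using (EReal.coe_eq_coe_iff.1 hlast : r + k (Fin.last m) = r)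

lemma isDualMaximizer_of_boundedP1 (hX : P.X.Nonempty) (ht : t ∈ dualFeasible T Y)
    (hbdd : P.BoundedP1 (dualWeight T t)) : IsDualMaximizer P T Y t := by
  refine ⟨ht, ⟨t, ht, rfl⟩, ?_⟩
  rintro k hk ⟨t', -, ht'⟩
  have hfst : (dualObj P T t').1 = (dualObj P T t).1 := by
    ext i
    simp [ht', extendReal, hk.1.1 i]
  rw [dualObj_eq_of_fst_eq hfst] at ht'
  refine add_extendReal_ne ?_ ?_ hk ht'.symm
  · obtain ⟨β, hβ⟩ := hbdd
    exact ((EReal.bot_lt_coe β).trans_le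
      (le_iInf₂ fun x hx => EReal.coe_le_coe_iff.2 (hβ ⟨x, hx, rfl⟩))).ne'
  · obtain ⟨x, hx⟩ := hX
    exact ((iInf₂_le x hx).trans_lt (EReal.coe_lt_top _)).ne

lemma IsBoundedWeight.isDualMaximizer {c w : Fin (m + 1) → ℝ} (hw : IsBoundedWeight P c w)
    (hT : IsUnit T.det) (hTc : ∀ i, T i (Fin.last m) = c i) (hX : P.X.Nonempty)
    (hwY : w ∈ posDual (cone Y)) : IsDualMaximizer P T Y (Tᵀ *ᵥ w) := by
  have hlast : (Tᵀ *ᵥ w) (Fin.last m) = 1 := by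
    rw [← hw.normalized, ← funext hTc]
    rfl
  have hweight := dualWeight_transpose_mulVec hT hlast
  refine isDualMaximizer_of_boundedP1 hX ?_ (hweight.symm ▸ hw.boundedP1)
  rwa [dualFeasible, Set.mem_ofPred_eq, hweight]

end GeometricDual

end UnboundedCVOP

open UnboundedCVOP in
theorem mainTheorem5_general {n m : ℕ} (P : Problem n (m + 1)) (hX : Convex ℝ P.X)
    (hΓ : P.IsCConvex) (c : Fin (m + 1) → ℝ) (hc : c ∈ interior P.C)
    (T : Matrix (Fin (m + 1)) (Fin (m + 1)) ℝ) (hT : IsUnit T.det)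
    (hTc : ∀ i, T i (Fin.last m) = c i)
    (R : Finset (Fin (m + 1) → ℝ)) (hR : cone (R : Set (Fin (m + 1) → ℝ)) = P.C)
    (Rstar : Finset (Fin (m + 1) → ℝ))
    (hRstar : cone (Rstar : Set (Fin (m + 1) → ℝ)) = posDual P.C)
    (hRstar1 : ∀ z ∈ Rstar, c ⬝ᵥ z = 1)
    (δ : ℝ) (s : AlgState n (m + 1)) (hs : AlgReturns P c T R Rstar δ s) :
    (fun y => Tᵀ *ᵥ y) ''
        {y | IsExtremeDirection (posDual (cone s.YOut)) y ∧ c ⬝ᵥ y = 1} ⊆ s.Tbar ∧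
      ∀ t ∈ s.Tbar, IsDualMaximizer P T s.YOut t := by
  obtain ⟨hXne, F, hF, hYOut⟩ := hs.exists_isCutFamily hX hΓ hc hT hR hRstar hRstar1
  rw [hF.Tbar_eq]
  refine ⟨Set.image_mono ?_, Set.forall_mem_image.2 fun w hw => ?_⟩
  · rintro y ⟨hy, hyc⟩
    rw [hYOut] at hy
    exact hy.mem_of_posDual_posDual ((hF.finite.image _).isClosed_convexHull ℝ)
      (fun w hw => (hF.isBoundedWeight w hw).normalized) hyc
  · exact (hF.isBoundedWeight w hw).isDualMaximizer hT hTc hXne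
      (hYOut ▸ subset_posDual_posDual _ hw)

theorem mainTheorem5 {n m : ℕ} (P : UnboundedCVOP.Problem n (m + 1)) (hP : P.Assumptions)
    (c : Fin (m + 1) → ℝ) (hc : c ∈ interior P.C) (hc1 : UnboundedCVOP.l1Norm c = 1)
    (T : Matrix (Fin (m + 1)) (Fin (m + 1)) ℝ) (hT : IsUnit T.det)
    (hTc : ∀ i, T i (Fin.last m) = c i)
    (R : Finset (Fin (m + 1) → ℝ)) (hR : UnboundedCVOP.cone (R : Set (Fin (m + 1) → ℝ)) = P.C)
    (hR1 : ∀ d ∈ R, UnboundedCVOP.l1Norm d = 1)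
    (Rstar : Finset (Fin (m + 1) → ℝ))
    (hRstar : UnboundedCVOP.cone (Rstar : Set (Fin (m + 1) → ℝ)) = UnboundedCVOP.posDual P.C)
    (hRstar1 : ∀ z ∈ Rstar, c ⬝ᵥ z = 1)
    (δ : ℝ) (hδ : 0 < δ)
    (s : UnboundedCVOP.AlgState n (m + 1))
    (hs : UnboundedCVOP.AlgReturns P c T R Rstar δ s) :
    (fun y => Tᵀ *ᵥ y) ''
        {y | UnboundedCVOP.IsExtremeDirection
          (UnboundedCVOP.posDual (UnboundedCVOP.cone s.YOut)) y ∧ c ⬝ᵥ y = 1} ⊆ s.Tbar ∧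
      ∀ t ∈ s.Tbar, UnboundedCVOP.IsDualMaximizer P T s.YOut t := by
  exact mainTheorem5_general P hP.X_convex hP.Γ_convex c hc T hT hTc R hR Rstar hRstar hRstar1
    δ s hs
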